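/- Let $A\in[-1,+1]^{m\times n}$. A set $H(A)\subseteq[m]$ is a hard core of $A$ if (i) some $\hat\lambda\in\mathbb R^n$ satisfies $(A\hat\lambda)_i<0$ for $i\notin H(A)$ and $(A\hat\lambda)_i=0$ for $i\in H(A)$, and (ii) every $\lambda\in\mathbb R^n$ with $(A\lambda)_i<0$ for some $i\in H(A)$ has $(A\lambda)_k>0$ for some $k\in H(A)$. For $\ell:\mathbb R\to(0,\infty)$ let $C_\ell(z)\in[1,\infty]$ be the smallest constant $C\ge 1$ with $C^{-1}\le e^{x}/\ell^{(i)}(x)\le C$ for all $x\le z$ and $i\in\{0,1,2\}$ ($C_\ell(z)=\infty$ if there is none). Let $\mathbb L_\infty$ be the set of twice continuously differentiable, strictly convex $\ell:\mathbb R\to(0,\infty)$ with $C_\ell(z)<\infty$ for all $z\in\mathbb R$ and $\lim_{z\to-\infty}C_\ell(z)=1$; each such $\ell$ is a bijection onto $(0,\infty)$. Put $\mathcal L(z)=\frac1m\sum_{i=1}^m\ell(z_i)$ for $z\in\mathbb R^m$. The boosting algorithm sets $\lambda_0=0$ and, for $t=1,2,\dots$, chooses $j_t\in\arg\max_j|\nabla\mathcal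 L(A\lambda_{t-1})^\top Ae_j|$ and $v_t\in\{\pm e_{j_t}\}$ with $\nabla\mathcal L(A\lambda_{t-1})^\top Av_t=-\|A^\top\nabla\mathcal L(A\lambda_{t-1})\|_\infty$, and sets $\lambda_t=\lambda_{t-1}+\alpha_tv_t$ for a step size $\alpha_t$. Write $\gamma_t=\|A^\top\nabla\mathcal L(A\lambda_{t-1})\|_\infty/\|\nabla\mathcal L(A\lambda_{t-1})\|_1$ and $C_t=C_\ell(\ell^{-1}(m\mathcal L(A\lambda_{t-1})))$. The margin of example $i\in[m]$ under $\lambda\neq 0$ is $-(A\lambda)_i/\|\lambda\|_1$. Theorem. Let $A\in[-1,+1]^{m\times n}$ have a hard core $H(A)$ with $1\le|H(A)|\le m-1$, let $\nu\in(0,1]$ and $\ell\in\mathbb L_\infty$, and let $(\lambda_t)_{t\ge0}$ be produced by the boosting algorithm with step sizes that follow one of these rules for all $t\ge1$: (a) (quadratic upper bound) $\alpha_t=\nu\gamma_t/C_t^4$; (b) (Wolfe) $\alpha_t$ is any $\alpha\in\mathbb R$ with $\mathcal L(A(\lambda_{t-1}+\alpha v_t))\le\mathcal L(A\lambda_{t-1})-\alpha(1-\nu/2)\|A^\top\nabla\mathcal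 L(A\lambda_{t-1})\|_\infty$ and $\nabla\mathcal L(A(\lambda_{t-1}+\alpha v_t))^\top Av_t\ge-(1-\nu/4)\|A^\top\nabla\mathcal L(A\lambda_{t-1})\|_\infty$; (c) (optimal) $\ell=\exp$, $A\in\{-1,+1\}^{m\times n}$, and $\alpha_t=\nu\bar\alpha_t$ with $\bar\alpha_t$ a minimizer of $\alpha\mapsto\mathcal L(A(\lambda_{t-1}+\alpha v_t))$ over $\mathbb R$; (d) (AdaBoost) $\ell=\exp$, $A\in\{-1,+1\}^{m\times n}$, and $\alpha_t=\frac\nu2\ln\frac{1+\gamma_t}{1-\gamma_t}$. Then there exist $\hat\gamma>0$ and $T$ such that, for all $t\ge T$, $\lambda_t\ne0$ and every example $i\in[m]\setminus H(A)$ has margin at least $\hat\gamma$ under $\lambda_t$. -/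

import Mathlib

open Filter Topology Matrix

noncomputable section

namespace Boosting

/-- `C` is an admissible relative curvature constant for `ℓ` on `(-∞, z]`: for every `x ≤ z`,
`C⁻¹ ≤ exp x / ℓ⁽ⁱ⁾(x) ≤ C` for `i = 0, 1, 2`. -/
def AdmissibleConst (ℓ : ℝ → ℝ) (z C : ℝ) : Prop :=
  1 ≤ C ∧ ∀ x ≤ z, ∀ i ≤ 2,
    C⁻¹ ≤ Real.exp x / iteratedDeriv i ℓ x ∧ Real.exp x / iteratedDeriv i ℓ x ≤ C

/-- `C_ℓ(z)`: the tightest admissible constant, equal to `∞` if there is none. -/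
def relConst (ℓ : ℝ → ℝ) (z : ℝ) : ENNReal :=
  sInf (ENNReal.ofReal '' {C : ℝ | AdmissibleConst ℓ z C})

/-- The loss class `𝕃`. -/
structure IsLoss (ℓ : ℝ → ℝ) : Prop where
  pos : ∀ x, 0 < ℓ x
  contDiff : ContDiff ℝ 2 ℓ
  strictConvex : StrictConvexOn ℝ Set.univ ℓ
  relConst_lt_top : ∀ z, relConst ℓ z < ⊤

/-- The loss class `𝕃_∞`. -/
structure IsLossInfty (ℓ : ℝ → ℝ) : Prop extends IsLoss ℓ where
  tendsto_relConst : Tendsto (relConst ℓ) atBot (𝓝 1)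

/-- The `l¹` norm. (The norm that Mathlib puts on `Fin k → ℝ` is the `l^∞` norm.) -/
def l1norm {k : ℕ} (x : Fin k → ℝ) : ℝ := ∑ i, |x i|

/-- `𝓛(z) = m⁻¹ ∑ᵢ ℓ(zᵢ)`. -/
def risk {m : ℕ} (ℓ : ℝ → ℝ) (z : Fin m → ℝ) : ℝ := (m : ℝ)⁻¹ * ∑ i, ℓ (z i)

/-- The gradient `∇𝓛(z)`, as the vector of partial derivatives. -/
def gradRisk {m : ℕ} (ℓ : ℝ → ℝ) (z : Fin m → ℝ) : Fin m → ℝ :=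
  fun i => fderiv ℝ (risk ℓ) z (Pi.single i 1)

variable {m n : ℕ}

/-- `Aᵀ ∇𝓛(Aμ)`. -/
def pullGrad (ℓ : ℝ → ℝ) (A : Matrix (Fin m) (Fin n) ℝ) (μ : Fin n → ℝ) : Fin n → ℝ :=
  Aᵀ *ᵥ gradRisk ℓ (A *ᵥ μ)

/-- `‖Aᵀ∇𝓛(Aμ)‖_∞ / ‖∇𝓛(Aμ)‖₁`; the quantity `γ_t` is its value at `μ = λ_{t-1}`. -/
def edge (ℓ : ℝ → ℝ) (A : Matrix (Fin m) (Fin n) ℝ) (μ : Fin n → ℝ) : ℝ :=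
  ‖pullGrad ℓ A μ‖ / l1norm (gradRisk ℓ (A *ᵥ μ))

/-- `C_ℓ(ℓ⁻¹(m 𝓛(Aμ)))`; the quantity `C_t` is its value at `μ = λ_{t-1}`. -/
def stepConst (ℓ : ℝ → ℝ) (A : Matrix (Fin m) (Fin n) ℝ) (μ : Fin n → ℝ) : ℝ :=
  (relConst ℓ (Function.invFun ℓ ((m : ℝ) * risk ℓ (A *ᵥ μ)))).toReal

/-- The direction `v` may be chosen by the algorithm at the point `μ = λ_{t-1}`: it is plus or
minus a basis vector of a column `j` maximizing `|∇𝓛(Aμ)ᵀ A e_j|`, and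
`∇𝓛(Aμ)ᵀ A v = -‖∇𝓛(Aμ)ᵀ A‖_∞`. -/
def IsDirection (ℓ : ℝ → ℝ) (A : Matrix (Fin m) (Fin n) ℝ) (μ v : Fin n → ℝ) : Prop :=
  (∃ j : Fin n, (∀ k, |pullGrad ℓ A μ k| ≤ |pullGrad ℓ A μ j|) ∧
    (v = Pi.single j 1 ∨ v = -Pi.single j 1)) ∧
  gradRisk ℓ (A *ᵥ μ) ⬝ᵥ (A *ᵥ v) = -‖pullGrad ℓ A μ‖

/-- `(λ_t)`, `(v_t)`, `(α_t)` are the iterates, directions and step sizes of a run of the boosting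
algorithm, with an arbitrary line search. Only `v_t`, `α_t` with `t ≥ 1` matter. -/
structure IsBoostRun (ℓ : ℝ → ℝ) (A : Matrix (Fin m) (Fin n) ℝ)
    (lam v : ℕ → Fin n → ℝ) (α : ℕ → ℝ) : Prop where
  init : lam 0 = 0
  direction : ∀ t, IsDirection ℓ A (lam t) (v (t + 1))
  update : ∀ t, lam (t + 1) = lam t + α (t + 1) • v (t + 1)

/-- Quadratic upper bound step at `μ = λ_{t-1}`. -/
def IsQubStep (ℓ : ℝ → ℝ) (A : Matrix (Fin m) (Fin n) ℝ) (ν : ℝ) (μ : Fin n → ℝ) (a : ℝ) : Prop :=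
  a = ν * edge ℓ A μ / stepConst ℓ A μ ^ 4

/-- Wolfe step at `μ = λ_{t-1}` along `v = v_t`. -/
def IsWolfeStep (ℓ : ℝ → ℝ) (A : Matrix (Fin m) (Fin n) ℝ) (ν : ℝ) (μ v : Fin n → ℝ)
    (a : ℝ) : Prop :=
  risk ℓ (A *ᵥ (μ + a • v)) ≤ risk ℓ (A *ᵥ μ) - a * (1 - ν / 2) * ‖pullGrad ℓ A μ‖ ∧
  gradRisk ℓ (A *ᵥ (μ + a • v)) ⬝ᵥ (A *ᵥ v) ≥ -(1 - ν / 4) * ‖pullGrad ℓ A μ‖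

/-- AdaBoost step at `μ = λ_{t-1}`. -/
def IsAdaStep (ℓ : ℝ → ℝ) (A : Matrix (Fin m) (Fin n) ℝ) (ν : ℝ) (μ : Fin n → ℝ) (a : ℝ) : Prop :=
  a = ν / 2 * Real.log ((1 + edge ℓ A μ) / (1 - edge ℓ A μ))

/-- Optimal step, shrunk by `ν`, at `μ = λ_{t-1}` along `v = v_t`. -/
def IsOptStep (ℓ : ℝ → ℝ) (A : Matrix (Fin m) (Fin n) ℝ) (ν : ℝ) (μ v : Fin n → ℝ)
    (a : ℝ) : Prop :=
  ∃ b : ℝ, (∀ c : ℝ, risk ℓ (A *ᵥ (μ + b • v)) ≤ risk ℓ (A *ᵥ (μ + c • v))) ∧ a = ν * b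

/-- `A ∈ {-1, +1}^{m × n}`. -/
def IsBinary (A : Matrix (Fin m) (Fin n) ℝ) : Prop := ∀ i j, A i j = -1 ∨ A i j = 1

/-- `H` is a hard core for `A`. -/
structure IsHardCore (A : Matrix (Fin m) (Fin n) ℝ) (H : Finset (Fin m)) : Prop where
  exists_weighting : ∃ μ : Fin n → ℝ, (∀ i ∉ H, (A *ᵥ μ) i < 0) ∧ ∀ i ∈ H, (A *ᵥ μ) i = 0
  hard : ∀ μ : Fin n → ℝ, (∃ i ∈ H, (A *ᵥ μ) i < 0) → ∃ k ∈ H, 0 < (A *ᵥ μ) k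

/-- The `l¹` margin of example `i` under the weighting `μ`. -/
def margin (A : Matrix (Fin m) (Fin n) ℝ) (μ : Fin n → ℝ) (i : Fin m) : ℝ :=
  -(A *ᵥ μ) i / l1norm μ

end Boosting

end

/-! Split the risk into its core and noncore parts. The excess `Δ` of the risk over the infimum of
the core part dominates the noncore risk, so `ℓ ((A λ)ᵢ) ≤ m Δ` off the core. It therefore suffices
to make `Δ` decay exponentially in the `l¹` norm of the iterate.

Two facts give this decay. The first is `gradient_domination`: on a sublevel set `κ Δ ≤ ‖Aᵀ∇𝓛‖_∞`.
Noncore gradient mass is controlled by testing the gradient against the separating weighting of the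
hard core. On the core, hardness makes sublevel sets bounded, so convexity bounds the core excess by
the gradient paired with a weighting of bounded norm. The second is `SufficientStep`: under each
rule the step is at least `c ‖Aᵀ∇𝓛‖_∞` and lowers the risk by at least `c α ‖Aᵀ∇𝓛‖_∞`, with `c`
depending only on a bound for the risk.

Together, `Δ` shrinks by a factor `1 - r α ≤ exp (-r α)` per step, where `r = c κ`. Since the norm
of the iterate is at most the sum of the steps, `Δ ≤ Δ₀ exp (-r ‖λ‖₁)`, hence `(A λ)ᵢ ≤ K - r ‖λ‖₁`
off the core. Moreover `Δ` loses at least `r² Δ²` per step, so it tends to zero. This forces `(A λ)ᵢ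
→ -∞` and thus `‖λ‖₁ → ∞`. The constant `K` is eventually absorbed, and the margin is at least `r /
2` (`exists_margin`). -/

namespace Boosting

variable {m n : ℕ} {ℓ : ℝ → ℝ} {A : Matrix (Fin m) (Fin n) ℝ} {H : Finset (Fin m)}

/-! ### The loss class -/

lemma AdmissibleConst.iteratedDeriv_pos {z C x : ℝ} (h : AdmissibleConst ℓ z C) (hx : x ≤ z)
    {i : ℕ} (hi : i ≤ 2) : 0 < iteratedDeriv i ℓ x := by
  have h1 := (h.2 x hx i hi).1
  have hC : 0 < C⁻¹ := inv_pos.2 (by linarith [h.1])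
  by_contra hneg
  have : Real.exp x / iteratedDeriv i ℓ x ≤ 0 :=
    div_nonpos_of_nonneg_of_nonpos (Real.exp_pos x).le (not_lt.1 hneg)
  linarith

lemma AdmissibleConst.exp_le {z C x : ℝ} (h : AdmissibleConst ℓ z C) (hx : x ≤ z)
    {i : ℕ} (hi : i ≤ 2) : Real.exp x ≤ C * iteratedDeriv i ℓ x :=
  (div_le_iff₀ (h.iteratedDeriv_pos hx hi)).1 (h.2 x hx i hi).2

lemma AdmissibleConst.le_exp {z C x : ℝ} (h : AdmissibleConst ℓ z C) (hx : x ≤ z)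
    {i : ℕ} (hi : i ≤ 2) : iteratedDeriv i ℓ x ≤ C * Real.exp x := by
  have h1 := (le_div_iff₀ (h.iteratedDeriv_pos hx hi)).1 (h.2 x hx i hi).1
  have hC : 0 < C := by linarith [h.1]
  rwa [inv_mul_le_iff₀ hC] at h1

lemma AdmissibleConst.iteratedDeriv_le {z C x : ℝ} (h : AdmissibleConst ℓ z C) (hx : x ≤ z)
    {i j : ℕ} (hi : i ≤ 2) (hj : j ≤ 2) :
    iteratedDeriv i ℓ x ≤ C ^ 2 * iteratedDeriv j ℓ x := by
  have h1 := h.le_exp hx hi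
  have h2 := mul_le_mul_of_nonneg_left (h.exp_le hx hj) (by linarith [h.1] : 0 ≤ C)
  calc _ ≤ _ := h1
    _ ≤ _ := h2
    _ = _ := by ring

lemma relConst_mono (ℓ : ℝ → ℝ) : Monotone (relConst ℓ) := by
  intro z z' hz
  refine sInf_le_sInf (Set.image_mono ?_)
  exact fun C hC => ⟨hC.1, fun x hx => hC.2 x (hx.trans hz)⟩

/-- The infimum is attained: each condition on `C` is a closed lower bound, with `C⁻¹ ≤ q` read as
`q⁻¹ ≤ C`. -/
lemma admissibleConst_relConst {z : ℝ} (h : relConst ℓ z < ⊤) :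
    AdmissibleConst ℓ z (relConst ℓ z).toReal := by
  set S := {C : ℝ | AdmissibleConst ℓ z C} with hS
  obtain ⟨_, ⟨C₀, hC₀, rfl⟩, -⟩ := sInf_lt_iff.1 h
  have key : ∀ a : ℝ, (∀ C ∈ S, a ≤ C) → a ≤ (relConst ℓ z).toReal := by
    intro a ha
    refine (ENNReal.ofReal_le_iff_le_toReal h.ne).1 (le_sInf ?_)
    rintro _ ⟨C, hC, rfl⟩
    exact ENNReal.ofReal_le_ofReal (ha C hC)
  refine ⟨key 1 fun C hC => hC.1, fun x hx i hi => ?_⟩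
  have hpos := hC₀.iteratedDeriv_pos hx hi
  have hq : 0 < Real.exp x / iteratedDeriv i ℓ x := div_pos (Real.exp_pos x) hpos
  refine ⟨?_, key _ fun C hC => (hC.2 x hx i hi).2⟩
  refine inv_le_of_inv_le₀ hq (key _ fun C hC => ?_)
  exact inv_le_of_inv_le₀ (by linarith [hC.1]) (hC.2 x hx i hi).1

namespace IsLoss

lemma admissible (h : IsLoss ℓ) (z : ℝ) : AdmissibleConst ℓ z (relConst ℓ z).toReal :=
  admissibleConst_relConst (h.relConst_lt_top z)

lemma iteratedDeriv_pos (h : IsLoss ℓ) (x : ℝ) {i : ℕ} (hi : i ≤ 2) :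
    0 < iteratedDeriv i ℓ x := (h.admissible x).iteratedDeriv_pos le_rfl hi

lemma deriv_pos (h : IsLoss ℓ) (x : ℝ) : 0 < deriv ℓ x := by
  simpa [iteratedDeriv_one] using h.iteratedDeriv_pos x (i := 1) (by norm_num)

lemma hasDerivAt (h : IsLoss ℓ) (x : ℝ) : HasDerivAt ℓ (deriv ℓ x) x :=
  (h.contDiff.differentiable (by norm_num) x).hasDerivAt

lemma hasDerivAt_deriv (h : IsLoss ℓ) (x : ℝ) :
    HasDerivAt (deriv ℓ) (iteratedDeriv 2 ℓ x) x := by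
  have h1 : ContDiff ℝ 1 (deriv ℓ) := by
    have := h.contDiff
    rw [show (2 : WithTop ℕ∞) = 1 + 1 by norm_num, contDiff_succ_iff_deriv] at this
    exact this.2.2
  have := (h1.differentiable (by norm_num) x).hasDerivAt
  rwa [show iteratedDeriv 2 ℓ = deriv (deriv ℓ) by
    rw [iteratedDeriv_succ, iteratedDeriv_one]]

lemma continuous (h : IsLoss ℓ) : Continuous ℓ := h.contDiff.continuous

lemma strictMono (h : IsLoss ℓ) : StrictMono ℓ := strictMono_of_deriv_pos h.deriv_pos

lemma sub_le (h : IsLoss ℓ) (x y : ℝ) : ℓ x - ℓ y ≤ deriv ℓ x * (x - y) := by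
  have hc := h.strictConvex.convexOn
  rcases lt_trichotomy x y with hxy | rfl | hxy
  · have := hc.deriv_le_slope (Set.mem_univ x) (Set.mem_univ y) hxy
      (h.hasDerivAt x).differentiableAt
    rw [slope_def_field, le_div_iff₀ (by linarith)] at this
    linarith
  · simp
  · have := hc.slope_le_deriv (Set.mem_univ y) (Set.mem_univ x) hxy
      (h.hasDerivAt x).differentiableAt
    rw [slope_def_field, div_le_iff₀ (by linarith)] at this
    linarith

lemma exists_eq (h : IsLoss ℓ) {y : ℝ} (hy : 0 < y) : ∃ x, ℓ x = y := by
  have hC := h.admissible 0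
  set C := (relConst ℓ 0).toReal
  have hC0 : 0 < C := by linarith [hC.1]
  -- Small values come from `ℓ ≤ C exp` on the negative axis, large ones from the tangent line at
  -- `0`.
  obtain ⟨a, ha⟩ : ∃ a, ℓ a ≤ y := by
    refine ⟨min 0 (Real.log (y / C)), ?_⟩
    have h1 := hC.le_exp (min_le_left 0 (Real.log (y / C))) (i := 0) (by norm_num)
    rw [iteratedDeriv_zero] at h1
    have h2 : Real.exp (min 0 (Real.log (y / C))) ≤ y / C := by
      rw [← Real.exp_log (div_pos hy hC0)]
      simp
    calc _ ≤ _ := h1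
      _ ≤ C * (y / C) := by gcongr
      _ = y := by field_simp
  obtain ⟨b, hb⟩ : ∃ b, y ≤ ℓ b := by
    refine ⟨y / deriv ℓ 0, ?_⟩
    have h1 := h.sub_le 0 (y / deriv ℓ 0)
    have h2 := h.deriv_pos 0
    have h3 := h.pos 0
    have h4 : deriv ℓ 0 * (0 - y / deriv ℓ 0) = - y := by field_simp; ring
    linarith
  exact mem_range_of_exists_le_of_exists_ge h.continuous ⟨a, ha⟩ ⟨b, hb⟩

/-- Positive reals lie in the range, so the default value of `Function.invFun` never enters the step
constants. -/
lemma apply_invFun (h : IsLoss ℓ) {y : ℝ} (hy : 0 < y) : ℓ (Function.invFun ℓ y) = y :=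
  Function.invFun_eq (h.exists_eq hy)

end IsLoss

/-! ### The risk and its gradient -/

lemma hasFDerivAt_risk (h : IsLoss ℓ) (z : Fin m → ℝ) :
    HasFDerivAt (risk ℓ) ((m : ℝ)⁻¹ • ∑ i, deriv ℓ (z i) •
      (ContinuousLinearMap.proj i : (Fin m → ℝ) →L[ℝ] ℝ)) z := by
  unfold risk
  refine HasFDerivAt.const_mul (HasFDerivAt.fun_sum fun i _ => ?_) _
  exact (h.hasDerivAt (z i)).comp_hasFDerivAt z (hasFDerivAt_apply i z)

lemma gradRisk_apply (h : IsLoss ℓ) (z : Fin m → ℝ) (i : Fin m) :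
    gradRisk ℓ z i = (m : ℝ)⁻¹ * deriv ℓ (z i) := by
  rw [gradRisk, (hasFDerivAt_risk h z).fderiv]
  simp [Pi.single_apply]

lemma gradRisk_pos (h : IsLoss ℓ) (z : Fin m → ℝ) (i : Fin m) : 0 < gradRisk ℓ z i := by
  rw [gradRisk_apply h]
  have : 0 < m := i.pos
  have := h.deriv_pos (z i)
  positivity

lemma l1norm_gradRisk (h : IsLoss ℓ) (z : Fin m → ℝ) :
    l1norm (gradRisk ℓ z) = ∑ i, gradRisk ℓ z i :=
  Finset.sum_congr rfl fun i _ => abs_of_pos (gradRisk_pos h z i)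

lemma risk_pos (h : IsLoss ℓ) (hm : 0 < m) (z : Fin m → ℝ) : 0 < risk ℓ z := by
  have : Nonempty (Fin m) := ⟨⟨0, hm⟩⟩
  exact mul_pos (by positivity) (Finset.sum_pos (fun i _ => h.pos _) Finset.univ_nonempty)

lemma apply_le_of_risk_le (h : IsLoss ℓ) {z : Fin m → ℝ} {Z : ℝ}
    (hz : (m : ℝ) * risk ℓ z ≤ ℓ Z) (i : Fin m) : z i ≤ Z := by
  have hm : (m : ℝ) ≠ 0 := by exact_mod_cast i.pos.ne'
  rw [risk, mul_inv_cancel_left₀ hm] at hz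
  refine h.strictMono.le_iff_le.1 (le_trans ?_ hz)
  exact Finset.single_le_sum (f := fun i => ℓ (z i)) (fun i _ => (h.pos _).le) (Finset.mem_univ i)

lemma sum_le_of_admissible {C Z : ℝ} (hC : AdmissibleConst ℓ Z C) {z : Fin m → ℝ}
    (hz : ∀ i, z i ≤ Z) {i j : ℕ} (hi : i ≤ 2) (hj : j ≤ 2) (s : Finset (Fin m)) :
    ∑ k ∈ s, (m : ℝ)⁻¹ * iteratedDeriv i ℓ (z k) ≤
      C ^ 2 * ∑ k ∈ s, (m : ℝ)⁻¹ * iteratedDeriv j ℓ (z k) := by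
  rw [Finset.mul_sum]
  refine Finset.sum_le_sum fun k _ => ?_
  have := mul_le_mul_of_nonneg_left (hC.iteratedDeriv_le (hz k) hi hj)
    (by positivity : (0 : ℝ) ≤ (m : ℝ)⁻¹)
  linarith

lemma risk_le_l1norm_gradRisk (h : IsLoss ℓ) {C Z : ℝ} (hC : AdmissibleConst ℓ Z C)
    {z : Fin m → ℝ} (hz : ∀ i, z i ≤ Z) : risk ℓ z ≤ C ^ 2 * l1norm (gradRisk ℓ z) := by
  have := sum_le_of_admissible hC hz (i := 0) (j := 1) (by norm_num) (by norm_num) Finset.univ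
  rw [l1norm_gradRisk h, risk, Finset.mul_sum]
  simpa only [iteratedDeriv_zero, iteratedDeriv_one, gradRisk_apply h] using this

lemma l1norm_gradRisk_le_risk (h : IsLoss ℓ) {C Z : ℝ} (hC : AdmissibleConst ℓ Z C)
    {z : Fin m → ℝ} (hz : ∀ i, z i ≤ Z) : l1norm (gradRisk ℓ z) ≤ C ^ 2 * risk ℓ z := by
  have := sum_le_of_admissible hC hz (i := 1) (j := 0) (by norm_num) (by norm_num) Finset.univ
  rw [l1norm_gradRisk h, risk, Finset.mul_sum]
  simpa only [iteratedDeriv_zero, iteratedDeriv_one, gradRisk_apply h] using this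

/-! ### The risk along a line -/

/-- The second derivative of the risk along a line. -/
noncomputable def lineCurv (ℓ : ℝ → ℝ) (z u : Fin m → ℝ) (s : ℝ) : ℝ :=
  ∑ i, (m : ℝ)⁻¹ * iteratedDeriv 2 ℓ ((z + s • u) i) * u i ^ 2

lemma hasDerivAt_line (z u : Fin m → ℝ) (s : ℝ) (i : Fin m) :
    HasDerivAt (fun s : ℝ => (z + s • u) i) (u i) s := by
  simpa using ((hasDerivAt_id s).mul_const (u i)).const_add (z i)

lemma hasDerivAt_risk_line (h : IsLoss ℓ) (z u : Fin m → ℝ) (s : ℝ) :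
    HasDerivAt (fun s : ℝ => risk ℓ (z + s • u)) (gradRisk ℓ (z + s • u) ⬝ᵥ u) s := by
  have : HasDerivAt (fun s : ℝ => risk ℓ (z + s • u))
      ((m : ℝ)⁻¹ * ∑ i, deriv ℓ ((z + s • u) i) * u i) s := by
    unfold risk
    refine HasDerivAt.const_mul _ (HasDerivAt.fun_sum fun i _ => ?_)
    exact (h.hasDerivAt ((z + s • u) i)).comp s (hasDerivAt_line z u s i)
  convert this using 1
  simp only [dotProduct, gradRisk_apply h, Finset.mul_sum, mul_assoc]

lemma hasDerivAt_gradRisk_line (h : IsLoss ℓ) (z u : Fin m → ℝ) (s : ℝ) :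
    HasDerivAt (fun s : ℝ => gradRisk ℓ (z + s • u) ⬝ᵥ u) (lineCurv ℓ z u s) s := by
  have : HasDerivAt (fun s : ℝ => ∑ i, (m : ℝ)⁻¹ * deriv ℓ ((z + s • u) i) * u i)
      (∑ i, (m : ℝ)⁻¹ * (iteratedDeriv 2 ℓ ((z + s • u) i) * u i) * u i) s := by
    refine HasDerivAt.fun_sum fun i _ => HasDerivAt.mul_const (HasDerivAt.const_mul _ ?_) _
    exact (h.hasDerivAt_deriv ((z + s • u) i)).comp s (hasDerivAt_line z u s i)
  simp only [dotProduct, gradRisk_apply h]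
  convert this using 1
  exact Finset.sum_congr rfl fun i _ => by ring

lemma lineCurv_nonneg (h : IsLoss ℓ) (z u : Fin m → ℝ) (s : ℝ) : 0 ≤ lineCurv ℓ z u s :=
  Finset.sum_nonneg fun i _ => by
    have := (h.iteratedDeriv_pos ((z + s • u) i) le_rfl).le
    positivity

lemma lineCurv_le (h : IsLoss ℓ) {C Z : ℝ} (hC : AdmissibleConst ℓ Z C) {z u : Fin m → ℝ}
    (hu : ∀ i, |u i| ≤ 1) {s : ℝ} (hs : (m : ℝ) * risk ℓ (z + s • u) ≤ ℓ Z) :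
    lineCurv ℓ z u s ≤ C ^ 2 * risk ℓ (z + s • u) := by
  have h1 := sum_le_of_admissible hC (apply_le_of_risk_le h hs) (i := 2) (j := 0) le_rfl
    (by norm_num) Finset.univ
  rw [risk, Finset.mul_sum]
  simp only [iteratedDeriv_zero] at h1
  refine le_trans (Finset.sum_le_sum fun i _ => ?_) h1
  have := (h.iteratedDeriv_pos ((z + s • u) i) le_rfl).le
  exact mul_le_of_le_one_right (by positivity) ((sq_le_one_iff_abs_le_one _).2 (hu i))

/-! ### One-dimensional descent -/

section Descent

variable {φ φ' φ'' : ℝ → ℝ}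

lemma deriv_le_of_curv_le (h' : ∀ s, HasDerivAt φ' (φ'' s) s) {M a : ℝ} (ha : 0 ≤ a)
    (hM : ∀ s ∈ Set.Icc 0 a, φ'' s ≤ M) : φ' a ≤ φ' 0 + M * a := by
  have hg : ∀ s, HasDerivAt (fun s => φ' s - M * s) (φ'' s - M) s := fun s => by
    have := (h' s).sub ((hasDerivAt_id' s).const_mul M)
    rwa [mul_one] at this
  have := antitoneOn_of_deriv_nonpos (convex_Icc 0 a)
    (fun s _ => (hg s).continuousAt.continuousWithinAt)
    (fun s _ => (hg s).differentiableAt.differentiableWithinAt)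
    (fun s hs => by
      rw [(hg s).deriv]; linarith [hM s (interior_subset hs)])
    (Set.left_mem_Icc.2 ha) (Set.right_mem_Icc.2 ha) ha
  simp only [mul_zero] at this
  linarith

lemma le_of_curv_le (h : ∀ s, HasDerivAt φ (φ' s) s) (h' : ∀ s, HasDerivAt φ' (φ'' s) s)
    {M a : ℝ} (ha : 0 ≤ a) (hM : ∀ s ∈ Set.Icc 0 a, φ'' s ≤ M) :
    φ a ≤ φ 0 + φ' 0 * a + M * a ^ 2 / 2 := by
  have hg : ∀ s, HasDerivAt (fun s => φ s - φ' 0 * s - M * s ^ 2 / 2)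
      (φ' s - φ' 0 - M * s) s := fun s => by
    have := ((h s).sub ((hasDerivAt_id' s).const_mul (φ' 0))).sub
      (((hasDerivAt_pow 2 s).const_mul M).div_const 2)
    refine this.congr_deriv ?_
    norm_num
    ring
  have := antitoneOn_of_deriv_nonpos (convex_Icc 0 a)
    (fun s _ => (hg s).continuousAt.continuousWithinAt)
    (fun s _ => (hg s).differentiableAt.differentiableWithinAt)
    (fun s hs => by
      have hs' := interior_subset hs
      have := deriv_le_of_curv_le h' hs'.1 fun r hr => hM r ⟨hr.1, hr.2.trans hs'.2⟩
      rw [(hg s).deriv]; linarith)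
    (Set.left_mem_Icc.2 ha) (Set.right_mem_Icc.2 ha) ha
  ring_nf at this ⊢
  linarith

lemma convexOn_of_curv_nonneg (h : ∀ s, HasDerivAt φ (φ' s) s)
    (h' : ∀ s, HasDerivAt φ' (φ'' s) s) (h0 : ∀ s, 0 ≤ φ'' s) : ConvexOn ℝ Set.univ φ := by
  have e : deriv φ = φ' := funext fun s => (h s).deriv
  refine MonotoneOn.convexOn_of_deriv convex_univ
    (fun s _ => (h s).continuousAt.continuousWithinAt)
    (fun s _ => (h s).differentiableAt.differentiableWithinAt) ?_
  rw [e]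
  exact (monotone_of_deriv_nonneg (fun s => (h' s).differentiableAt)
    (fun s => by rw [(h' s).deriv]; exact h0 s)).monotoneOn _

lemma le_apply_zero_of_convexOn (hc : ConvexOn ℝ Set.univ φ) {a s : ℝ}
    (ha : φ a ≤ φ 0) (hs : s ∈ Set.Icc 0 a) : φ s ≤ φ 0 := by
  have := hc.le_max_of_mem_Icc (Set.mem_univ 0) (Set.mem_univ a) hs
  rwa [max_eq_left ha] at this

/-- Sufficient decrease when the curvature bound is only known on the sublevel set. -/
lemma sufficient_decrease (h : ∀ s, HasDerivAt φ (φ' s) s)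
    (h' : ∀ s, HasDerivAt φ' (φ'' s) s) (h0 : ∀ s, 0 ≤ φ'' s) {M G a : ℝ} (hG : 0 < G)
    (hφ0 : φ' 0 = -G) (hM : ∀ s, φ s ≤ φ 0 → φ'' s ≤ M) (ha : 0 ≤ a) (haM : M * a ≤ G) :
    φ a ≤ φ 0 - a * G + M * a ^ 2 / 2 := by
  have hc := convexOn_of_curv_nonneg h h' h0
  have main : ∀ b, 0 ≤ b → φ b ≤ φ 0 → φ b ≤ φ 0 - b * G + M * b ^ 2 / 2 := by
    intro b hb hφb
    have := le_of_curv_le h h' hb fun s hs => hM s (le_apply_zero_of_convexOn hc hφb hs)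
    rw [hφ0] at this
    linarith
  -- If the step left the sublevel set, `φ` would dip below `φ 0` and return to it at some `b ≤ a`.
  -- By convexity the curvature bound holds on all of `[0, b]`, and with `M b ≤ G` it gives `φ b ≤ φ
  -- 0 - b G / 2`, a contradiction.
  refine main a ha ?_
  by_contra! hlt
  have hapos : 0 < a := lt_of_le_of_ne ha (by rintro rfl; exact lt_irrefl _ hlt)
  obtain ⟨s, hs0, hs⟩ : ∃ s ∈ Set.Ioo 0 a, φ s < φ 0 := by
    have hev : ∀ᶠ s in 𝓝[>] (0 : ℝ), slope φ 0 s < 0 := by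
      have := (hasDerivAt_iff_tendsto_slope.1 (h 0)).mono_left
        (nhdsWithin_mono 0 (fun x hx => ne_of_gt hx) : 𝓝[>] (0 : ℝ) ≤ 𝓝[≠] 0)
      exact this.eventually (gt_mem_nhds (by rw [hφ0]; linarith))
    obtain ⟨s, hs, hsa⟩ := (hev.and (Ioo_mem_nhdsGT hapos)).exists
    refine ⟨s, hsa, ?_⟩
    rw [slope_def_field, sub_zero, div_lt_iff₀ hsa.1] at hs
    linarith
  have hcont : ContinuousOn φ (Set.Icc s a) := fun s _ =>
    (h s).continuousAt.continuousWithinAt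
  obtain ⟨b, hb, hφb⟩ := intermediate_value_Icc hs0.2.le hcont ⟨hs.le, hlt.le⟩
  have hb0 : 0 < b := hs0.1.trans_le hb.1
  have := main b hb0.le hφb.le
  have hM0 : 0 ≤ M := (h0 0).trans (hM 0 le_rfl)
  have h5 : M * b ≤ G := (mul_le_mul_of_nonneg_left hb.2 hM0).trans haM
  nlinarith [mul_le_mul_of_nonneg_right h5 hb0.le, mul_pos hb0 hG]

end Descent

/-! ### The `l¹` norm and the pulled-back gradient -/

lemma l1norm_nonneg {k : ℕ} (x : Fin k → ℝ) : 0 ≤ l1norm x :=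
  Finset.sum_nonneg fun _ _ => abs_nonneg _

lemma l1norm_add_le {k : ℕ} (x y : Fin k → ℝ) : l1norm (x + y) ≤ l1norm x + l1norm y := by
  rw [l1norm, l1norm, l1norm, ← Finset.sum_add_distrib]
  exact Finset.sum_le_sum fun i _ => abs_add_le _ _

lemma l1norm_smul {k : ℕ} (c : ℝ) (x : Fin k → ℝ) : l1norm (c • x) = |c| * l1norm x := by
  simp [l1norm, abs_mul, Finset.mul_sum]

lemma l1norm_le {k : ℕ} (x : Fin k → ℝ) : l1norm x ≤ k * ‖x‖ := by
  have := Finset.sum_le_card_nsmul Finset.univ (fun i => |x i|) ‖x‖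
    fun i _ => norm_le_pi_norm x i
  simpa [l1norm] using this

lemma dotProduct_le_norm_mul_l1norm {k : ℕ} (g w : Fin k → ℝ) : |g ⬝ᵥ w| ≤ ‖g‖ * l1norm w := by
  rw [dotProduct, l1norm, Finset.mul_sum]
  refine (Finset.abs_sum_le_sum_abs _ _).trans (Finset.sum_le_sum fun i _ => ?_)
  rw [abs_mul]
  exact mul_le_mul_of_nonneg_right (norm_le_pi_norm g i) (abs_nonneg _)

lemma abs_mulVec_le (hA : ∀ i j, A i j ∈ Set.Icc (-1 : ℝ) 1) (w : Fin n → ℝ) (i : Fin m) :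
    |(A *ᵥ w) i| ≤ l1norm w := by
  rw [mulVec, dotProduct]
  refine (Finset.abs_sum_le_sum_abs _ _).trans (Finset.sum_le_sum fun j _ => ?_)
  rw [abs_mul]
  exact mul_le_of_le_one_left (abs_nonneg _) (abs_le.2 ⟨(hA i j).1, (hA i j).2⟩)

lemma abs_gradRisk_dotProduct_le (μ w : Fin n → ℝ) :
    |gradRisk ℓ (A *ᵥ μ) ⬝ᵥ (A *ᵥ w)| ≤ ‖pullGrad ℓ A μ‖ * l1norm w := by
  have : gradRisk ℓ (A *ᵥ μ) ⬝ᵥ (A *ᵥ w) = pullGrad ℓ A μ ⬝ᵥ w := by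
    rw [pullGrad, dotProduct_mulVec, mulVec_transpose]
  rw [this]
  exact dotProduct_le_norm_mul_l1norm _ _

lemma IsDirection.l1norm_eq {μ v : Fin n → ℝ} (h : IsDirection ℓ A μ v) : l1norm v = 1 := by
  obtain ⟨⟨j, -, rfl | rfl⟩, -⟩ := h <;> simp [l1norm, Pi.single_apply, apply_ite abs]

lemma IsDirection.abs_mulVec_le {μ v : Fin n → ℝ} (h : IsDirection ℓ A μ v)
    (hA : ∀ i j, A i j ∈ Set.Icc (-1 : ℝ) 1) (i : Fin m) : |(A *ᵥ v) i| ≤ 1 :=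
  (Boosting.abs_mulVec_le hA v i).trans h.l1norm_eq.le

/-! ### The hard core -/

/-- The matrix `A` with the rows outside `H` set to zero. -/
def coreMatrix (A : Matrix (Fin m) (Fin n) ℝ) (H : Finset (Fin m)) : Matrix (Fin m) (Fin n) ℝ :=
  Matrix.of fun i j => if i ∈ H then A i j else 0

lemma coreMatrix_mulVec_of_mem (μ : Fin n → ℝ) {i : Fin m} (hi : i ∈ H) :
    (coreMatrix A H *ᵥ μ) i = (A *ᵥ μ) i := by
  simp [coreMatrix, mulVec, dotProduct, hi]

lemma coreMatrix_mulVec_of_notMem (μ : Fin n → ℝ) {i : Fin m} (hi : i ∉ H) :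
    (coreMatrix A H *ᵥ μ) i = 0 := by
  simp [coreMatrix, mulVec, dotProduct, hi]

lemma IsHardCore.exists_pos_of_ne_zero (hH : IsHardCore A H) {μ : Fin n → ℝ}
    (hμ : coreMatrix A H *ᵥ μ ≠ 0) : ∃ k ∈ H, 0 < (coreMatrix A H *ᵥ μ) k := by
  by_contra! hcon
  apply hμ
  ext i
  by_cases hi : i ∈ H
  · refine le_antisymm (hcon i hi) ?_
    by_contra! hneg
    rw [Pi.zero_apply, coreMatrix_mulVec_of_mem μ hi] at hneg
    obtain ⟨k, hk, hpos⟩ := hH.hard μ ⟨i, hi, hneg⟩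
    have := hcon k hk
    rw [coreMatrix_mulVec_of_mem μ hk] at this
    linarith
  · exact coreMatrix_mulVec_of_notMem μ hi

/-- By hardness the largest core coordinate is positive at every nonzero point of the range of the
core matrix. Compactness of the unit sphere of this range and homogeneity make this quantitative. -/
lemma IsHardCore.exists_mul_norm_le (hH : IsHardCore A H) (hne : H.Nonempty) :
    ∃ δ : ℝ, 0 < δ ∧ ∀ μ : Fin n → ℝ, ∃ k ∈ H,
      δ * ‖coreMatrix A H *ᵥ μ‖ ≤ (A *ᵥ μ) k := by
  set V := LinearMap.range (coreMatrix A H).mulVecLin with hV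
  set f : V → ℝ := fun z => H.sup' hne fun k => (z : Fin m → ℝ) k with hf
  have hfc : Continuous f := Continuous.finset_sup'_apply hne fun k _ =>
    (continuous_apply k).comp continuous_subtype_val
  have hfpos : ∀ z : V, z ≠ 0 → 0 < f z := by
    rintro ⟨z, μ, rfl⟩ hz
    obtain ⟨k, hk, hpos⟩ := hH.exists_pos_of_ne_zero (μ := μ) fun h => hz (Subtype.ext h)
    exact (Finset.lt_sup'_iff hne).2 ⟨k, hk, hpos⟩
  obtain ⟨δ, hδ, hmin⟩ : ∃ δ : ℝ, 0 < δ ∧ ∀ z ∈ Metric.sphere (0 : V) 1, δ ≤ f z := by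
    -- The sphere is empty when the core matrix vanishes.
    rcases (Metric.sphere (0 : V) 1).eq_empty_or_nonempty with he | hs
    · exact ⟨1, one_pos, by simp [he]⟩
    · obtain ⟨z, hz, hzmin⟩ := (isCompact_sphere (0 : V) 1).exists_isMinOn hs hfc.continuousOn
      refine ⟨f z, hfpos z ?_, fun w hw => hzmin hw⟩
      rintro rfl
      simp at hz
  refine ⟨δ, hδ, fun μ => ?_⟩
  set w := coreMatrix A H *ᵥ μ with hw
  by_cases h0 : w = 0
  · obtain ⟨k, hk⟩ := hne
    refine ⟨k, hk, ?_⟩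
    rw [← coreMatrix_mulVec_of_mem μ hk, ← hw, h0]
    simp
  · have hn : 0 < ‖w‖ := norm_pos_iff.2 h0
    have hmem : ‖w‖⁻¹ • w ∈ V := V.smul_mem _ ⟨μ, rfl⟩
    have h1 := hmin ⟨_, hmem⟩ (by
      rw [mem_sphere_zero_iff_norm, Submodule.coe_norm, norm_smul, norm_inv, norm_norm,
        inv_mul_cancel₀ hn.ne'])
    obtain ⟨k, hk, hle⟩ := (Finset.le_sup'_iff hne).1 h1
    refine ⟨k, hk, ?_⟩
    rw [← coreMatrix_mulVec_of_mem μ hk, ← hw]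
    simp only [Pi.smul_apply, smul_eq_mul] at hle
    rw [inv_mul_eq_div, le_div_iff₀ hn] at hle
    exact hle

lemma IsHardCore.exists_core_bound (hH : IsHardCore A H) (hne : H.Nonempty) (Z : ℝ) :
    ∃ B : ℝ, 0 ≤ B ∧ ∀ μ : Fin n → ℝ, (∀ i ∈ H, (A *ᵥ μ) i ≤ Z) →
      ‖coreMatrix A H *ᵥ μ‖ ≤ B := by
  obtain ⟨δ, hδ, h⟩ := hH.exists_mul_norm_le hne
  refine ⟨|Z| / δ, by positivity, fun μ hμ => ?_⟩
  obtain ⟨k, hk, hle⟩ := h μ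
  rw [le_div_iff₀ hδ]
  linarith [hμ k hk, le_abs_self Z]

/-- A linear right inverse onto the range is bounded in finite dimension; the factor `n` passes from
the sup norm to the `l¹` norm. -/
lemma exists_bounded_preimage (M : Matrix (Fin m) (Fin n) ℝ) :
    ∃ K : ℝ, 0 ≤ K ∧ ∀ μ : Fin n → ℝ, ∃ w : Fin n → ℝ,
      M *ᵥ w = M *ᵥ μ ∧ l1norm w ≤ K * ‖M *ᵥ μ‖ := by
  obtain ⟨g, hg⟩ := M.mulVecLin.rangeRestrict.exists_rightInverse_of_surjective
    M.mulVecLin.range_rangeRestrict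
  refine ⟨n * ‖LinearMap.toContinuousLinearMap g‖, by positivity, fun μ => ?_⟩
  set y := M.mulVecLin.rangeRestrict μ with hy
  refine ⟨g y, ?_, ?_⟩
  · have := congrArg Subtype.val (LinearMap.congr_fun hg y)
    simpa [hy] using this
  · refine (l1norm_le _).trans ?_
    rw [mul_assoc]
    exact mul_le_mul_of_nonneg_left ((LinearMap.toContinuousLinearMap g).le_opNorm y)
      (Nat.cast_nonneg n)

lemma IsHardCore.exists_separation (hH : IsHardCore A H) :
    ∃ (μ : Fin n → ℝ) (η : ℝ), 0 < η ∧ (∀ i ∉ H, (A *ᵥ μ) i ≤ -η) ∧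
      ∀ i ∈ H, (A *ᵥ μ) i = 0 := by
  obtain ⟨μ, hneg, hzero⟩ := hH.exists_weighting
  rcases (Hᶜ).eq_empty_or_nonempty with he | hne
  · exact ⟨μ, 1, one_pos, fun i hi => absurd (Finset.mem_compl.2 hi) (by simp [he]), hzero⟩
  · obtain ⟨i₀, hi₀, hmin⟩ := Finset.exists_max_image Hᶜ (fun i => (A *ᵥ μ) i) hne
    refine ⟨μ, -(A *ᵥ μ) i₀, ?_, fun i hi => ?_, hzero⟩
    · linarith [hneg i₀ (Finset.mem_compl.1 hi₀)]
    · rw [neg_neg]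
      exact hmin i (Finset.mem_compl.2 hi)

/-! ### Gradient domination -/

/-- The part of the risk that is due to the hard core. -/
noncomputable def coreRisk (ℓ : ℝ → ℝ) (H : Finset (Fin m)) (z : Fin m → ℝ) : ℝ :=
  ∑ i ∈ H, (m : ℝ)⁻¹ * ℓ (z i)

/-- The infimum of the core risk. -/
noncomputable def coreInf (ℓ : ℝ → ℝ) (A : Matrix (Fin m) (Fin n) ℝ) (H : Finset (Fin m)) : ℝ :=
  ⨅ μ : Fin n → ℝ, coreRisk ℓ H (A *ᵥ μ)

lemma coreRisk_nonneg (h : IsLoss ℓ) (z : Fin m → ℝ) : 0 ≤ coreRisk ℓ H z :=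
  Finset.sum_nonneg fun i _ => mul_nonneg (by positivity) (h.pos _).le

lemma coreInf_le (h : IsLoss ℓ) (μ : Fin n → ℝ) : coreInf ℓ A H ≤ coreRisk ℓ H (A *ᵥ μ) :=
  ciInf_le ⟨0, by rintro _ ⟨μ, rfl⟩; exact coreRisk_nonneg h _⟩ μ

lemma risk_eq_coreRisk_add (z : Fin m → ℝ) :
    risk ℓ z = coreRisk ℓ H z + coreRisk ℓ Hᶜ z := by
  rw [risk, Finset.mul_sum, coreRisk, coreRisk, Finset.sum_add_sum_compl]

lemma coreRisk_compl_le (h : IsLoss ℓ) (μ : Fin n → ℝ) :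
    coreRisk ℓ Hᶜ (A *ᵥ μ) ≤ risk ℓ (A *ᵥ μ) - coreInf ℓ A H := by
  rw [risk_eq_coreRisk_add (H := H)]
  linarith [coreInf_le (A := A) (H := H) h μ]

lemma loss_le_excess (h : IsLoss ℓ) (μ : Fin n → ℝ) {i : Fin m} (hi : i ∉ H) :
    ℓ ((A *ᵥ μ) i) ≤ m * (risk ℓ (A *ᵥ μ) - coreInf ℓ A H) := by
  have hm : (0 : ℝ) < m := by exact_mod_cast i.pos
  refine le_trans ?_ (mul_le_mul_of_nonneg_left (coreRisk_compl_le h μ) hm.le)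
  have := Finset.single_le_sum (f := fun i => (m : ℝ)⁻¹ * ℓ ((A *ᵥ μ) i))
    (fun i _ => mul_nonneg (by positivity) (h.pos _).le) (Finset.mem_compl.2 hi)
  rw [← inv_mul_le_iff₀ hm]
  exact this

lemma coreRisk_sub_le (h : IsLoss ℓ) (z z' : Fin m → ℝ) :
    coreRisk ℓ H z - coreRisk ℓ H z' ≤ ∑ i ∈ H, gradRisk ℓ z i * (z i - z' i) := by
  rw [coreRisk, coreRisk, ← Finset.sum_sub_distrib]
  refine Finset.sum_le_sum fun i _ => ?_
  rw [gradRisk_apply h, ← mul_sub, mul_assoc]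
  exact mul_le_mul_of_nonneg_left (h.sub_le _ _) (by positivity)

lemma le_of_coreRisk_le (h : IsLoss ℓ) {z : Fin m → ℝ} {Z : ℝ}
    (hz : (m : ℝ) * coreRisk ℓ H z ≤ ℓ Z) {i : Fin m} (hi : i ∈ H) : z i ≤ Z := by
  have hm : (0 : ℝ) < m := by exact_mod_cast i.pos
  refine h.strictMono.le_iff_le.1 (le_trans ?_ hz)
  rw [← inv_mul_le_iff₀ hm]
  exact Finset.single_le_sum (f := fun i => (m : ℝ)⁻¹ * ℓ (z i))
    (fun i _ => mul_nonneg (by positivity) (h.pos _).le) hi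

/-- Pair the gradient with the separating weighting: core rows contribute nothing, and each noncore
row contributes at most `-η` times its positive partial derivative. -/
lemma IsHardCore.exists_noncore_grad_le (hH : IsHardCore A H) (h : IsLoss ℓ) :
    ∃ S : ℝ, 0 ≤ S ∧ ∀ μ : Fin n → ℝ,
      ∑ i ∈ Hᶜ, gradRisk ℓ (A *ᵥ μ) i ≤ S * ‖pullGrad ℓ A μ‖ := by
  obtain ⟨w, η, hη, hneg, hzero⟩ := hH.exists_separation
  refine ⟨l1norm w / η, div_nonneg (l1norm_nonneg _) hη.le, fun μ => ?_⟩
  have h1 := (abs_le.1 (abs_gradRisk_dotProduct_le (ℓ := ℓ) (A := A) μ w)).1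
  rw [dotProduct, ← Finset.sum_add_sum_compl H, Finset.sum_eq_zero (s := H), zero_add] at h1
  · have h2 : ∑ i ∈ Hᶜ, gradRisk ℓ (A *ᵥ μ) i * (A *ᵥ w) i ≤
        ∑ i ∈ Hᶜ, gradRisk ℓ (A *ᵥ μ) i * -η := Finset.sum_le_sum fun i hi =>
      mul_le_mul_of_nonneg_left (hneg i (Finset.mem_compl.1 hi)) (gradRisk_pos h _ i).le
    rw [← Finset.sum_mul] at h2
    rw [div_mul_eq_mul_div, le_div_iff₀ hη]
    linarith
  · intro i hi
    rw [hzero i hi, mul_zero]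

/-- On a sublevel set the gradient dominates the excess risk over the core infimum. -/
lemma IsHardCore.gradient_domination (hH : IsHardCore A H) (hne : H.Nonempty) (h : IsLoss ℓ)
    (hA : ∀ i j, A i j ∈ Set.Icc (-1 : ℝ) 1) {b : ℝ} (hb : 0 < b) :
    ∃ κ : ℝ, 0 < κ ∧ ∀ μ : Fin n → ℝ, risk ℓ (A *ᵥ μ) ≤ b →
      κ * (risk ℓ (A *ᵥ μ) - coreInf ℓ A H) ≤ ‖pullGrad ℓ A μ‖ := by
  have hm : (0 : ℝ) < m := by exact_mod_cast hne.choose.pos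
  obtain ⟨Z, hZ⟩ := h.exists_eq (mul_pos hm hb)
  have hC := h.admissible Z
  set C := (relConst ℓ Z).toReal
  obtain ⟨S, hS0, hS⟩ := hH.exists_noncore_grad_le h
  obtain ⟨B, hB0, hB⟩ := hH.exists_core_bound hne Z
  obtain ⟨K, hK0, hK⟩ := exists_bounded_preimage (coreMatrix A H)
  set D := K * (B + B) with hD
  have hD0 : 0 ≤ D := by positivity
  set R := (C ^ 2 + D) * S + D with hR
  have hR0 : 0 ≤ R := by positivity
  -- The excess is at most `R` times the gradient norm; adding `1` keeps the constant invertible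
  -- when `R = 0`.
  refine ⟨(R + 1)⁻¹, by positivity, fun μ hμ => ?_⟩
  set q := ∑ i ∈ Hᶜ, gradRisk ℓ (A *ᵥ μ) i with hq
  set G := ‖pullGrad ℓ A μ‖ with hG
  have hG0 : 0 ≤ G := norm_nonneg _
  have hq0 : 0 ≤ q := Finset.sum_nonneg fun i _ => (gradRisk_pos h _ i).le
  have hzZ : ∀ i, (A *ᵥ μ) i ≤ Z := apply_le_of_risk_le h (by rw [hZ]; gcongr)
  have hp : coreRisk ℓ Hᶜ (A *ᵥ μ) ≤ C ^ 2 * q := by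
    have := sum_le_of_admissible hC hzZ (i := 0) (j := 1) (by norm_num) (by norm_num) Hᶜ
    simpa only [coreRisk, hq, gradRisk_apply h, iteratedDeriv_zero, iteratedDeriv_one] using this
  -- Competitors with core risk above `b` are harmless. For the others, replace `μ - μ'` by a
  -- weighting `w` of norm at most `D` with the same core image. Convexity bounds the core
  -- difference by the core part of `∇𝓛ᵀ A w`; the full pairing costs `D G`, and removing its
  -- noncore part costs `D q`.
  have hcore : ∀ μ', coreRisk ℓ H (A *ᵥ μ) - (D * G + D * q) ≤ coreRisk ℓ H (A *ᵥ μ') := by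
    intro μ'
    by_cases hμ' : coreRisk ℓ H (A *ᵥ μ') ≤ b
    · have hz'Z : ∀ i ∈ H, (A *ᵥ μ') i ≤ Z := fun i hi =>
        le_of_coreRisk_le h (by rw [hZ]; gcongr) hi
      obtain ⟨w, hw, hwD⟩ := hK (μ - μ')
      have hwD' : l1norm w ≤ D := by
        refine hwD.trans (mul_le_mul_of_nonneg_left ?_ hK0)
        rw [mulVec_sub]
        exact (norm_sub_le _ _).trans
          (add_le_add (hB μ fun i _ => hzZ i) (hB μ' hz'Z))
      have hsub := coreRisk_sub_le (H := H) h (A *ᵥ μ) (A *ᵥ μ')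
      have heq : ∑ i ∈ H, gradRisk ℓ (A *ᵥ μ) i * ((A *ᵥ μ) i - (A *ᵥ μ') i) =
          ∑ i ∈ H, gradRisk ℓ (A *ᵥ μ) i * (A *ᵥ w) i := by
        refine Finset.sum_congr rfl fun i hi => ?_
        have := congrFun hw i
        rw [coreMatrix_mulVec_of_mem _ hi, coreMatrix_mulVec_of_mem _ hi, mulVec_sub,
          Pi.sub_apply] at this
        rw [this]
      have hdot := (abs_le.1 (abs_gradRisk_dotProduct_le (ℓ := ℓ) (A := A) μ w)).2
      rw [dotProduct, ← Finset.sum_add_sum_compl H] at hdot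
      have hrest : ∑ i ∈ Hᶜ, gradRisk ℓ (A *ᵥ μ) i * -D ≤
          ∑ i ∈ Hᶜ, gradRisk ℓ (A *ᵥ μ) i * (A *ᵥ w) i := Finset.sum_le_sum fun i _ =>
        mul_le_mul_of_nonneg_left
          (by linarith [(abs_le.1 ((abs_mulVec_le hA w i).trans hwD')).1]) (gradRisk_pos h _ i).le
      rw [← Finset.sum_mul] at hrest
      have hGD : G * l1norm w ≤ G * D := mul_le_mul_of_nonneg_left hwD' hG0
      linarith
    · have := risk_eq_coreRisk_add (ℓ := ℓ) (H := H) (A *ᵥ μ)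
      have := coreRisk_nonneg (H := Hᶜ) h (A *ᵥ μ)
      have : 0 ≤ D * G + D * q := by positivity
      linarith
  have hinf : coreRisk ℓ H (A *ᵥ μ) - (D * G + D * q) ≤ coreInf ℓ A H := le_ciInf hcore
  rw [inv_mul_le_iff₀ (by positivity), risk_eq_coreRisk_add (H := H)]
  have hqS := mul_le_mul_of_nonneg_left (hS μ) (by positivity : 0 ≤ C ^ 2 + D)
  have : (R + 1) * G = (C ^ 2 + D) * (S * G) + D * G + G := by rw [hR]; ring
  linarith

/-! ### Step sizes -/

/-- The step `a` along `v` is at least `c` times the size of the gradient, and decreases the risk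
by at least `c` times the first-order prediction. -/
def SufficientStep (ℓ : ℝ → ℝ) (A : Matrix (Fin m) (Fin n) ℝ) (c : ℝ) (μ v : Fin n → ℝ)
    (a : ℝ) : Prop :=
  c * ‖pullGrad ℓ A μ‖ ≤ a ∧
    risk ℓ (A *ᵥ (μ + a • v)) ≤ risk ℓ (A *ᵥ μ) - c * (a * ‖pullGrad ℓ A μ‖)

lemma exists_qub_constant (h : IsLoss ℓ) (hm : 0 < m) (hA : ∀ i j, A i j ∈ Set.Icc (-1 : ℝ) 1)
    {ν : ℝ} (hν : ν ∈ Set.Ioc (0 : ℝ) 1) {b : ℝ} (hb : 0 < b) :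
    ∃ c : ℝ, 0 < c ∧ ∀ μ v a, risk ℓ (A *ᵥ μ) ≤ b → 0 < ‖pullGrad ℓ A μ‖ →
      IsDirection ℓ A μ v → IsQubStep ℓ A ν μ a → SufficientStep ℓ A c μ v a := by
  have hm' : (0 : ℝ) < m := by exact_mod_cast hm
  have hm0 : Nonempty (Fin m) := ⟨⟨0, hm⟩⟩
  set Z := Function.invFun ℓ (m * b) with hZdef
  have hZ : ℓ Z = m * b := h.apply_invFun (by positivity)
  have hC0 := h.admissible Z
  set C₀ := (relConst ℓ Z).toReal with hC₀
  have hC0pos : 0 < C₀ := by linarith [hC0.1]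
  refine ⟨min (1 / 2) (ν / (C₀ ^ 4 * (C₀ ^ 2 * b))),
    lt_min (by norm_num) (div_pos hν.1 (by positivity)), ?_⟩
  intro μ v a hμ hG hdir ha
  have hν0 := hν.1
  set z := A *ᵥ μ with hz
  set u := A *ᵥ v with hu
  set G := ‖pullGrad ℓ A μ‖ with hGdef
  have hL := risk_pos h hm z
  set z' := Function.invFun ℓ (m * risk ℓ z) with hz'
  have hZ' : ℓ z' = m * risk ℓ z := h.apply_invFun (by positivity)
  have hC := h.admissible z'
  set C := (relConst ℓ z').toReal with hCdef
  have hCpos : 0 < C := by linarith [hC.1]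
  have hzz : z' ≤ Z := h.strictMono.le_iff_le.1 (by rw [hZ, hZ']; gcongr)
  have hCC : C ≤ C₀ :=
    ENNReal.toReal_mono (h.relConst_lt_top Z).ne (relConst_mono ℓ hzz)
  set N := l1norm (gradRisk ℓ z) with hN
  have hNpos : 0 < N := by
    rw [hN, l1norm_gradRisk h]
    exact Finset.sum_pos (fun i _ => gradRisk_pos h z i) Finset.univ_nonempty
  have hNb : N ≤ C₀ ^ 2 * b :=
    (l1norm_gradRisk_le_risk h hC0 fun i =>
      apply_le_of_risk_le h (by rw [hZ]; gcongr) i).trans (by gcongr)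
  have haeq : a = ν * G / (C ^ 4 * N) := by
    have : a = ν * (G / N) / C ^ 4 := ha
    rw [this]; field_simp
  have ha0 : 0 < a := by rw [haeq]; positivity
  have hMa : C ^ 4 * N * a = ν * G := by rw [haeq]; field_simp
  have hlow : ν / (C₀ ^ 4 * (C₀ ^ 2 * b)) * G ≤ a := by
    rw [haeq, div_mul_eq_mul_div]
    gcongr
  -- On the sublevel set the curvature is at most `C² 𝓛 ≤ C⁴ N`, and the rule is exactly `C⁴ N a = ν
  -- G`.
  have hdec := sufficient_decrease (fun s => hasDerivAt_risk_line h z u s)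
    (fun s => hasDerivAt_gradRisk_line h z u s) (lineCurv_nonneg h z u) (M := C ^ 4 * N) hG
    (a := a) (by simpa [hGdef, hz, hu] using hdir.2)
    (fun s hs => by
      simp only [zero_smul, add_zero] at hs
      refine (lineCurv_le h hC (hdir.abs_mulVec_le hA) (by rw [hZ']; gcongr)).trans ?_
      have := risk_le_l1norm_gradRisk h hC (apply_le_of_risk_le h hZ'.ge)
      calc C ^ 2 * risk ℓ (z + s • u) ≤ C ^ 2 * (C ^ 2 * N) := by
            gcongr; exact hs.trans this
        _ = C ^ 4 * N := by ring) ha0.le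
    (by rw [hMa]; exact mul_le_of_le_one_left hG.le hν.2)
  refine ⟨(mul_le_mul_of_nonneg_right (min_le_right _ _) hG.le).trans hlow, ?_⟩
  rw [mulVec_add, mulVec_smul, ← hz, ← hu]
  simp only [zero_smul, add_zero] at hdec
  have h1 : min (1 / 2) (ν / (C₀ ^ 4 * (C₀ ^ 2 * b))) * (a * G) ≤ 1 / 2 * (a * G) :=
    mul_le_mul_of_nonneg_right (min_le_left _ _) (by positivity)
  have h2 : C ^ 4 * N * a ^ 2 ≤ a * G := by
    calc C ^ 4 * N * a ^ 2 = ν * (a * G) := by rw [pow_two, ← mul_assoc, hMa]; ring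
      _ ≤ a * G := mul_le_of_le_one_left (by positivity) hν.2
  linarith

lemma exists_wolfe_constant (h : IsLoss ℓ) (hm : 0 < m) (hA : ∀ i j, A i j ∈ Set.Icc (-1 : ℝ) 1)
    {ν : ℝ} (hν : ν ∈ Set.Ioc (0 : ℝ) 1) {b : ℝ} (hb : 0 < b) :
    ∃ c : ℝ, 0 < c ∧ ∀ μ v a, risk ℓ (A *ᵥ μ) ≤ b → 0 < ‖pullGrad ℓ A μ‖ →
      IsDirection ℓ A μ v → IsWolfeStep ℓ A ν μ v a → SufficientStep ℓ A c μ v a := by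
  have hm' : (0 : ℝ) < m := by exact_mod_cast hm
  obtain ⟨Z, hZ⟩ := h.exists_eq (mul_pos hm' hb)
  have hC := h.admissible Z
  set C := (relConst ℓ Z).toReal
  have hCpos : 0 < C := by linarith [hC.1]
  refine ⟨min (1 / 2) (ν / (4 * (C ^ 2 * b))),
    lt_min (by norm_num) (div_pos hν.1 (by positivity)), ?_⟩
  intro μ v a hμ hG hdir ha
  have hν0 := hν.1
  unfold IsWolfeStep SufficientStep at *
  rw [mulVec_add, mulVec_smul] at *
  have hslope := hdir.2
  have hu := hdir.abs_mulVec_le hA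
  set z := A *ᵥ μ with hz
  set u := A *ᵥ v
  set G := ‖pullGrad ℓ A μ‖ with hGdef
  obtain ⟨ha1, ha2⟩ := ha
  have hd := hasDerivAt_risk_line h z u
  have hd' := hasDerivAt_gradRisk_line h z u
  have hmono : Monotone fun s : ℝ => gradRisk ℓ (z + s • u) ⬝ᵥ u :=
    monotone_of_deriv_nonneg (fun s => (hd' s).differentiableAt)
      (fun s => by rw [(hd' s).deriv]; exact lineCurv_nonneg h z u s)
  have hνG : 0 < ν * G := mul_pos hν0 hG
  -- At a nonpositive step the slope is at most `-G` by monotonicity, contradicting the second Wolfe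
  -- condition.
  have ha0 : 0 < a := by
    by_contra! hneg
    have := hmono hneg
    simp only [zero_smul, add_zero] at this
    linarith
  have haG : 0 < a * G := mul_pos ha0 hG
  have hle : risk ℓ (z + a • u) ≤ risk ℓ (z + (0 : ℝ) • u) := by
    have : 0 ≤ a * (1 - ν / 2) * G :=
      mul_nonneg (mul_nonneg ha0.le (by linarith [hν.2])) hG.le
    simp only [zero_smul, add_zero]
    linarith
  -- The slope must rise by at least `ν G / 4` at rate at most `C² b`, which bounds the step from
  -- below.
  have hcurv := deriv_le_of_curv_le hd' ha0.le (M := C ^ 2 * b) fun s hs => by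
    have h1 := le_apply_zero_of_convexOn
      (convexOn_of_curv_nonneg hd hd' (lineCurv_nonneg h z u)) hle hs
    simp only [zero_smul, add_zero] at h1
    have h2 := h1.trans hμ
    exact (lineCurv_le h hC hu (by rw [hZ]; gcongr)).trans (by gcongr)
  simp only [zero_smul, add_zero] at hcurv
  constructor
  · refine (mul_le_mul_of_nonneg_right (min_le_right _ _) hG.le).trans ?_
    rw [div_mul_eq_mul_div, div_le_iff₀ (by positivity)]
    linarith
  · have h1 : min (1 / 2) (ν / (4 * (C ^ 2 * b))) * (a * G) ≤ 1 / 2 * (a * G) :=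
      mul_le_mul_of_nonneg_right (min_le_left _ _) (by positivity)
    have h2 : ν * (a * G) ≤ 1 * (a * G) := mul_le_mul_of_nonneg_right hν.2 haG.le
    linarith

/-! ### Exponential loss and binary matrices -/

/-- For `u = ±1` one has `exp (s u) = cosh s + u sinh s`. -/
lemma risk_exp_line {z u : Fin m → ℝ} (h : IsLoss Real.exp) (hu : ∀ i, u i = -1 ∨ u i = 1)
    {G : ℝ} (hG : gradRisk Real.exp z ⬝ᵥ u = -G) (s : ℝ) :
    risk Real.exp (z + s • u) =
      (risk Real.exp z - G) / 2 * Real.exp s + (risk Real.exp z + G) / 2 * Real.exp (-s) := by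
  have key : ∀ i, Real.exp ((z + s • u) i) =
      Real.exp (z i) * ((Real.exp s + Real.exp (-s)) / 2) +
        Real.exp (z i) * u i * ((Real.exp s - Real.exp (-s)) / 2) := by
    intro i
    rcases hu i with hi | hi <;> simp [hi, Real.exp_add] <;> ring
  have hG' : (m : ℝ)⁻¹ * ∑ i, Real.exp (z i) * u i = -G := by
    rw [← hG, Finset.mul_sum]
    simp only [dotProduct, gradRisk_apply h, Real.deriv_exp, mul_assoc]
  have : risk Real.exp (z + s • u) =
      risk Real.exp z * ((Real.exp s + Real.exp (-s)) / 2) +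
        (m : ℝ)⁻¹ * (∑ i, Real.exp (z i) * u i) * ((Real.exp s - Real.exp (-s)) / 2) := by
    simp only [risk, key, Finset.sum_add_distrib, ← Finset.sum_mul]
    ring
  rw [this, hG']
  ring

lemma l1norm_gradRisk_exp (h : IsLoss Real.exp) (z : Fin m → ℝ) :
    l1norm (gradRisk Real.exp z) = risk Real.exp z := by
  rw [l1norm_gradRisk h, risk, Finset.mul_sum]
  simp [gradRisk_apply h]

lemma IsDirection.mulVec_binary {μ v : Fin n → ℝ} (h : IsDirection ℓ A μ v) (hA : IsBinary A)
    (i : Fin m) : (A *ᵥ v) i = -1 ∨ (A *ᵥ v) i = 1 := by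
  obtain ⟨⟨j, -, rfl | rfl⟩, -⟩ := h
  · simpa using hA i j
  · rcases hA i j with hj | hj <;> simp [mulVec_neg, hj]

/-- This keeps the edge away from `1`. By hardness a column cannot be `-1` on the whole core, so
some core row has `(A v)ₖ = 1`. That row contributes `2 exp ((A μ)ₖ) / m` to the gap, and core
coordinates are bounded below on a sublevel set. -/
lemma IsHardCore.exists_binary_gap (hH : IsHardCore A H) (hne : H.Nonempty)
    (h : IsLoss Real.exp) (hA : IsBinary A) {b : ℝ} (hb : 0 < b) :
    ∃ δ : ℝ, 0 < δ ∧ ∀ μ v, risk Real.exp (A *ᵥ μ) ≤ b → IsDirection Real.exp A μ v →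
      δ ≤ risk Real.exp (A *ᵥ μ) - ‖pullGrad Real.exp A μ‖ := by
  have hm' : (0 : ℝ) < m := by exact_mod_cast hne.choose.pos
  obtain ⟨Z, hZ⟩ := h.exists_eq (mul_pos hm' hb)
  obtain ⟨B, hB0, hB⟩ := hH.exists_core_bound hne Z
  refine ⟨(m : ℝ)⁻¹ * (Real.exp (-B) * 2), by positivity, fun μ v hμ hdir => ?_⟩
  have hz : ∀ i, (A *ᵥ μ) i ≤ Z := apply_le_of_risk_le h (by rw [hZ]; gcongr)
  have hu := hdir.mulVec_binary hA
  obtain ⟨k, hk, hk1⟩ : ∃ k ∈ H, (A *ᵥ v) k = 1 := by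
    by_contra! hcon
    obtain ⟨i, hi⟩ := hne
    have hall : ∀ k ∈ H, (A *ᵥ v) k = -1 := fun k hk => (hu k).resolve_right (hcon k hk)
    obtain ⟨k, hk, hpos⟩ := hH.hard v ⟨i, hi, by rw [hall i hi]; norm_num⟩
    rw [hall k hk] at hpos
    norm_num at hpos
  have hzk : -B ≤ (A *ᵥ μ) k := by
    have := (norm_le_pi_norm (coreMatrix A H *ᵥ μ) k).trans (hB μ fun i _ => hz i)
    rw [coreMatrix_mulVec_of_mem μ hk] at this
    exact (abs_le.1 this).1
  have heq : risk Real.exp (A *ᵥ μ) - ‖pullGrad Real.exp A μ‖ =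
      ∑ i, (m : ℝ)⁻¹ * (Real.exp ((A *ᵥ μ) i) * (1 + (A *ᵥ v) i)) := by
    rw [sub_eq_add_neg, ← hdir.2, risk, Finset.mul_sum, dotProduct, ← Finset.sum_add_distrib]
    refine Finset.sum_congr rfl fun i _ => ?_
    rw [gradRisk_apply h, Real.deriv_exp]
    ring
  rw [heq]
  refine le_trans ?_ (Finset.single_le_sum
    (f := fun i => (m : ℝ)⁻¹ * (Real.exp ((A *ᵥ μ) i) * (1 + (A *ᵥ v) i)))
    (fun i _ => ?_) (Finset.mem_univ k))
  · simp only [hk1]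
    norm_num
    gcongr
  · rcases hu i with hi | hi <;> simp only [hi] <;> norm_num
    positivity

lemma half_log_bounds {γ δ : ℝ} (hγ : 0 ≤ γ) (hδ : 0 < δ) (hγδ : δ ≤ 1 - γ) :
    γ / 2 ≤ 1 / 2 * Real.log ((1 + γ) / (1 - γ)) ∧
      1 / 2 * Real.log ((1 + γ) / (1 - γ)) ≤ γ / δ := by
  have h1 : 0 < 1 - γ := by linarith
  have h2 : 0 < 1 + γ := by linarith
  constructor
  · have := Real.one_sub_inv_le_log_of_pos (div_pos h2 h1)
    have e : 1 - ((1 + γ) / (1 - γ))⁻¹ = 2 * γ / (1 + γ) := by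
      field_simp; ring
    have : γ ≤ 2 * γ / (1 + γ) := by
      rw [le_div_iff₀ h2]
      nlinarith
    linarith
  · have := Real.log_le_sub_one_of_pos (div_pos h2 h1)
    have e : (1 + γ) / (1 - γ) - 1 = 2 * (γ / (1 - γ)) := by
      field_simp; ring
    have : γ / (1 - γ) ≤ γ / δ := by gcongr
    linarith

/-- Convexity of `exp` reduces to `ν = 1`, where both terms equal half of `√(1 - γ²)`, which is at
most `1 - γ² / 2`. -/
lemma exp_descent {γ ν : ℝ} (hγ : 0 ≤ γ) (hγ1 : γ < 1) (hν : ν ∈ Set.Ioc (0 : ℝ) 1) :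
    (1 - γ) / 2 * Real.exp (ν / 2 * Real.log ((1 + γ) / (1 - γ))) +
      (1 + γ) / 2 * Real.exp (-(ν / 2 * Real.log ((1 + γ) / (1 - γ)))) ≤ 1 - ν * γ ^ 2 / 2 := by
  have h1 : 0 < 1 - γ := by linarith
  have h2 : 0 < 1 + γ := by linarith
  set x := 1 / 2 * Real.log ((1 + γ) / (1 - γ)) with hx
  have e : ν / 2 * Real.log ((1 + γ) / (1 - γ)) = ν * x := by rw [hx]; ring
  have hconv : ∀ y : ℝ, Real.exp (ν * y) ≤ (1 - ν) + ν * Real.exp y := by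
    intro y
    have := convexOn_exp.2 (Set.mem_univ 0) (Set.mem_univ y) (by linarith [hν.2] : 0 ≤ 1 - ν)
      hν.1.le (by ring)
    simpa using this
  have hrr : Real.exp x * Real.exp x = (1 + γ) / (1 - γ) := by
    rw [← Real.exp_add, hx, ← add_mul]
    norm_num
    exact Real.exp_log (div_pos h2 h1)
  have hr := Real.exp_pos x
  have hinv : (1 + γ) * Real.exp (-x) = (1 - γ) * Real.exp x := by
    rw [Real.exp_neg, ← div_eq_mul_inv, div_eq_iff hr.ne', mul_assoc, hrr]
    field_simp
  have hval : (1 - γ) * Real.exp x ≤ 1 - γ ^ 2 / 2 := by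
    refine abs_le_of_sq_le_sq' ?_ (by nlinarith) |>.2
    have : ((1 - γ) * Real.exp x) ^ 2 = (1 - γ) * (1 + γ) := by
      rw [mul_pow, pow_two (Real.exp x), hrr]
      field_simp
    rw [this]
    nlinarith [sq_nonneg (γ ^ 2)]
  have h3 := hconv x
  have h4 := hconv (-x)
  rw [e, ← mul_neg]
  calc _ ≤ (1 - γ) / 2 * ((1 - ν) + ν * Real.exp x) +
        (1 + γ) / 2 * ((1 - ν) + ν * Real.exp (-x)) := by gcongr
    _ = (1 - ν) + ν * ((1 - γ) * Real.exp x) := by linear_combination ν / 2 * hinv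
    _ ≤ (1 - ν) + ν * (1 - γ ^ 2 / 2) := by gcongr; exact hν.1.le
    _ = _ := by ring

lemma IsHardCore.exists_ada_constant (hH : IsHardCore A H) (hne : H.Nonempty)
    (h : IsLoss Real.exp) (hA : IsBinary A) {ν : ℝ} (hν : ν ∈ Set.Ioc (0 : ℝ) 1)
    {b : ℝ} (hb : 0 < b) :
    ∃ c : ℝ, 0 < c ∧ ∀ μ v a, risk Real.exp (A *ᵥ μ) ≤ b → IsDirection Real.exp A μ v →
      IsAdaStep Real.exp A ν μ a → SufficientStep Real.exp A c μ v a := by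
  obtain ⟨δ₀, hδ₀, hgap⟩ := hH.exists_binary_gap hne h hA hb
  set δ := δ₀ / b with hδ
  have hδpos : 0 < δ := by positivity
  -- The second entry comes from `a ≥ ν γ / 2` and `L ≤ b`. The first makes `c a G` at most the
  -- guaranteed decrease `L ν γ² / 2`, because `a ≤ ν γ / δ`.
  refine ⟨min (δ / 2) (ν / (2 * b)), lt_min (by positivity) (div_pos hν.1 (by positivity)), ?_⟩
  intro μ v a hμ hdir ha
  have hν0 := hν.1
  have hL := risk_pos h hne.choose.pos (A *ᵥ μ)
  have hg := hgap μ v hμ hdir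
  have hγdef : edge Real.exp A μ = ‖pullGrad Real.exp A μ‖ / risk Real.exp (A *ᵥ μ) := by
    rw [edge, l1norm_gradRisk_exp h]
  have hline := risk_exp_line h (hdir.mulVec_binary hA) hdir.2 a
  rw [IsAdaStep] at ha
  rw [SufficientStep, mulVec_add, mulVec_smul, hline]
  have hGnn := norm_nonneg (pullGrad Real.exp A μ)
  set L := risk Real.exp (A *ᵥ μ)
  set G := ‖pullGrad Real.exp A μ‖
  set γ := edge Real.exp A μ
  have hGL : G = γ * L := by rw [hγdef]; field_simp
  have hγ0 : 0 ≤ γ := by rw [hγdef]; positivity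
  have hγδ : δ ≤ 1 - γ := by
    have h1 : 1 - γ = (L - G) / L := by rw [hγdef]; field_simp
    rw [h1, hδ]
    gcongr
    linarith
  obtain ⟨hlow, hup⟩ := half_log_bounds hγ0 hδpos hγδ
  have ha' : a = ν * (1 / 2 * Real.log ((1 + γ) / (1 - γ))) := by rw [ha]; ring
  have hdesc := mul_le_mul_of_nonneg_left (exp_descent hγ0 (by linarith : γ < 1) hν) hL.le
  rw [← ha] at hdesc
  have halow : ν * (γ / 2) ≤ a := by rw [ha']; gcongr
  have haup : a ≤ ν * (γ / δ) := by rw [ha']; gcongr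
  have ha0 : 0 ≤ a := le_trans (by positivity) halow
  constructor
  · refine (mul_le_mul_of_nonneg_right (min_le_right _ _) hGnn).trans (le_trans ?_ halow)
    rw [div_mul_eq_mul_div, div_le_iff₀ (by positivity), hGL]
    have : ν * γ * L ≤ ν * γ * b := by gcongr
    linarith
  · have h1 : min (δ / 2) (ν / (2 * b)) * (a * G) ≤ δ / 2 * (ν * (γ / δ) * G) := by
      gcongr
      exact min_le_left _ _
    have h2 : δ / 2 * (ν * (γ / δ) * G) = L * (ν * γ ^ 2 / 2) := by
      rw [hGL]; field_simp
    rw [hGL] at h1 h2 ⊢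
    linarith

/-- Stationarity of the explicit line function gives `exp (2 b) = (L + G) / (L - G)`, so the
minimizer is the unshrunk AdaBoost step. -/
lemma IsOptStep.isAdaStep {μ v : Fin n → ℝ} {ν a : ℝ} (h : IsLoss Real.exp) (hm : 0 < m)
    (hA : IsBinary A) (hdir : IsDirection Real.exp A μ v)
    (hgap : ‖pullGrad Real.exp A μ‖ < risk Real.exp (A *ᵥ μ))
    (ha : IsOptStep Real.exp A ν μ v a) : IsAdaStep Real.exp A ν μ a := by
  obtain ⟨b, hmin, rfl⟩ := ha
  have hline := risk_exp_line h (hdir.mulVec_binary hA) hdir.2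
  have hL := risk_pos h hm (A *ᵥ μ)
  have hGnn := norm_nonneg (pullGrad Real.exp A μ)
  rw [IsAdaStep, edge, l1norm_gradRisk_exp h]
  simp only [mulVec_add, mulVec_smul, hline] at hmin
  set L := risk Real.exp (A *ᵥ μ)
  set G := ‖pullGrad Real.exp A μ‖
  have hd : HasDerivAt (fun s : ℝ => (L - G) / 2 * Real.exp s + (L + G) / 2 * Real.exp (-s))
      ((L - G) / 2 * Real.exp b + (L + G) / 2 * (Real.exp (-b) * -1)) b :=
    ((Real.hasDerivAt_exp b).const_mul _).add (((hasDerivAt_neg b).exp).const_mul _)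
  have hloc : IsLocalMin
      (fun s : ℝ => (L - G) / 2 * Real.exp s + (L + G) / 2 * Real.exp (-s)) b :=
    Eventually.of_forall hmin
  have h0 := hloc.hasDerivAt_eq_zero hd
  have hLG : 0 < L - G := by linarith
  have hexp : Real.exp (2 * b) = (1 + G / L) / (1 - G / L) := by
    have e1 : Real.exp (2 * b) = Real.exp b * Real.exp b := by rw [← Real.exp_add, two_mul]
    have e2 : (1 + G / L) / (1 - G / L) = (L + G) / (L - G) := by
      have : 1 - G / L = (L - G) / L := by field_simp
      rw [this]; field_simp
    have e3 : Real.exp (-b) * Real.exp b = 1 := by rw [← Real.exp_add]; simp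
    rw [e2, eq_div_iff hLG.ne', e1]
    linear_combination 2 * Real.exp b * h0 + (L + G) * e3
  rw [← hexp, Real.log_exp]
  ring

lemma IsHardCore.exists_opt_constant (hH : IsHardCore A H) (hne : H.Nonempty)
    (h : IsLoss Real.exp) (hA : IsBinary A) {ν : ℝ} (hν : ν ∈ Set.Ioc (0 : ℝ) 1)
    {b : ℝ} (hb : 0 < b) :
    ∃ c : ℝ, 0 < c ∧ ∀ μ v a, risk Real.exp (A *ᵥ μ) ≤ b → IsDirection Real.exp A μ v →
      IsOptStep Real.exp A ν μ v a → SufficientStep Real.exp A c μ v a := by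
  obtain ⟨c, hc, hada⟩ := hH.exists_ada_constant hne h hA hν hb
  obtain ⟨δ, hδ, hgap⟩ := hH.exists_binary_gap hne h hA hb
  refine ⟨c, hc, fun μ v a hμ hdir ha => hada μ v a hμ hdir ?_⟩
  exact ha.isAdaStep h hne.choose.pos hA hdir (by linarith [hgap μ v hμ hdir])

/-! ### Convergence and margins -/

lemma exists_le_of_quadratic_decrease {Δ : ℕ → ℝ} {c : ℝ} (hc : 0 < c) (h0 : ∀ t, 0 ≤ Δ t)
    (h : ∀ t, Δ (t + 1) ≤ Δ t - c * Δ t ^ 2) {ε : ℝ} (hε : 0 < ε) :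
    ∃ T, ∀ t ≥ T, Δ t ≤ ε := by
  have hanti : Antitone Δ := antitone_nat_of_succ_le fun t => by
    have := h t
    have : 0 ≤ c * Δ t ^ 2 := by positivity
    linarith
  -- As `Δ` is nonincreasing, failure keeps it above `ε` forever, so it drops by at least `c ε²` at
  -- every step and becomes negative.
  by_contra! hcon
  have hbig : ∀ t, ε ≤ Δ t := fun t => by
    obtain ⟨s, hs, hlt⟩ := hcon t
    exact hlt.le.trans (hanti hs)
  have hlin : ∀ t : ℕ, Δ t ≤ Δ 0 - t * (c * ε ^ 2) := by
    intro t
    induction t with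
    | zero => simp
    | succ t ih =>
      have h1 : c * ε ^ 2 ≤ c * Δ t ^ 2 := by gcongr; exact hbig t
      push_cast
      linarith [h t]
  obtain ⟨t, ht⟩ := exists_nat_gt (Δ 0 / (c * ε ^ 2))
  rw [div_lt_iff₀ (by positivity)] at ht
  linarith [hlin t, h0 t]

/-- The separating weighting is a strict descent direction at every point, so no iterate is
stationary. -/
lemma IsHardCore.pullGrad_norm_pos (hH : IsHardCore A H) (h : IsLoss ℓ) {i : Fin m} (hi : i ∉ H)
    (μ : Fin n → ℝ) : 0 < ‖pullGrad ℓ A μ‖ := by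
  obtain ⟨S, hS0, hS⟩ := hH.exists_noncore_grad_le h
  have h1 : 0 < ∑ i ∈ Hᶜ, gradRisk ℓ (A *ᵥ μ) i :=
    Finset.sum_pos (fun i _ => gradRisk_pos h _ i) ⟨i, Finset.mem_compl.2 hi⟩
  exact pos_of_mul_pos_right (h1.trans_le (hS μ)) hS0

/-- A run whose steps all decrease the risk sufficiently has positive margins off the hard core. -/
lemma IsHardCore.exists_margin (hH : IsHardCore A H) (hne : H.Nonempty)
    (hA : ∀ i j, A i j ∈ Set.Icc (-1 : ℝ) 1) (h : IsLoss ℓ) {lam v : ℕ → Fin n → ℝ} {α : ℕ → ℝ}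
    (hrun : IsBoostRun ℓ A lam v α) {c : ℝ} (hc : 0 < c)
    (hstep : ∀ t, risk ℓ (A *ᵥ lam t) ≤ risk ℓ (A *ᵥ lam 0) →
      SufficientStep ℓ A c (lam t) (v (t + 1)) (α (t + 1))) :
    ∃ γ' : ℝ, 0 < γ' ∧ ∃ T : ℕ, ∀ t ≥ T, ∀ i ∉ H, γ' ≤ margin A (lam t) i := by
  have hm : 0 < m := hne.choose.pos
  have hm' : (0 : ℝ) < m := by exact_mod_cast hm
  have hb := risk_pos h hm (A *ᵥ lam 0)
  set b := risk ℓ (A *ᵥ lam 0) with hbdef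
  have hα : ∀ t, risk ℓ (A *ᵥ lam t) ≤ b → 0 ≤ α (t + 1) := fun t ht =>
    le_trans (by positivity) (hstep t ht).1
  have hdec : ∀ t, risk ℓ (A *ᵥ lam t) ≤ b → risk ℓ (A *ᵥ lam (t + 1)) ≤
      risk ℓ (A *ᵥ lam t) - c * (α (t + 1) * ‖pullGrad ℓ A (lam t)‖) := fun t ht => by
    rw [hrun.update t]; exact (hstep t ht).2
  have hle : ∀ t, risk ℓ (A *ᵥ lam t) ≤ b := by
    intro t
    induction t with
    | zero => exact le_rfl
    | succ t ih =>
      have h1 := hdec t ih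
      have h2 : 0 ≤ c * (α (t + 1) * ‖pullGrad ℓ A (lam t)‖) :=
        mul_nonneg hc.le (mul_nonneg (hα t ih) (norm_nonneg _))
      linarith
  obtain ⟨κ, hκ, hdom⟩ := hH.gradient_domination hne h hA hb
  set Δ : ℕ → ℝ := fun t => risk ℓ (A *ᵥ lam t) - coreInf ℓ A H with hΔ
  have hΔ0 : ∀ t, 0 ≤ Δ t := fun t =>
    le_trans (coreRisk_nonneg (H := Hᶜ) h _) (coreRisk_compl_le h _)
  have hdomΔ : ∀ t, κ * Δ t ≤ ‖pullGrad ℓ A (lam t)‖ := fun t => hdom _ (hle t)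
  have hstepΔ : ∀ t, Δ (t + 1) ≤ Δ t - c * (α (t + 1) * (κ * Δ t)) := by
    intro t
    have h1 := hdec t (hle t)
    have h2 : c * (α (t + 1) * (κ * Δ t)) ≤ c * (α (t + 1) * ‖pullGrad ℓ A (lam t)‖) :=
      mul_le_mul_of_nonneg_left (mul_le_mul_of_nonneg_left (hdomΔ t) (hα t (hle t))) hc.le
    simp only [hΔ] at h2 ⊢
    linarith
  have hquad : ∀ t, Δ (t + 1) ≤ Δ t - c ^ 2 * κ ^ 2 * Δ t ^ 2 := by
    intro t
    have h1 : c * (κ * Δ t) ≤ α (t + 1) :=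
      (mul_le_mul_of_nonneg_left (hdomΔ t) hc.le).trans (hstep t (hle t)).1
    have h2 := mul_le_mul_of_nonneg_left
      (mul_le_mul_of_nonneg_right h1 (mul_nonneg hκ.le (hΔ0 t))) hc.le
    have h3 := hstepΔ t
    linarith [show c * (c * (κ * Δ t) * (κ * Δ t)) = c ^ 2 * κ ^ 2 * Δ t ^ 2 by ring]
  set r := c * κ with hr
  have hrpos : 0 < r := mul_pos hc hκ
  have hexp : ∀ t, Δ t ≤ Δ 0 * Real.exp (-(r * l1norm (lam t))) := by
    intro t
    induction t with
    | zero => simp [hrun.init, l1norm]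
    | succ t ih =>
      have ha := hα t (hle t)
      -- Only an inequality: steps of opposite sign along one coordinate may cancel.
      have hnorm : l1norm (lam (t + 1)) ≤ l1norm (lam t) + α (t + 1) := by
        rw [hrun.update t]
        refine (l1norm_add_le _ _).trans ?_
        rw [l1norm_smul, (hrun.direction t).l1norm_eq, abs_of_nonneg ha, mul_one]
      have h1 : 1 - r * α (t + 1) ≤ Real.exp (-(r * α (t + 1))) := by
        linarith [Real.add_one_le_exp (-(r * α (t + 1)))]
      calc Δ (t + 1) ≤ Δ t * (1 - r * α (t + 1)) := by
            refine (hstepΔ t).trans (le_of_eq ?_); rw [hr]; ring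
        _ ≤ Δ t * Real.exp (-(r * α (t + 1))) := mul_le_mul_of_nonneg_left h1 (hΔ0 t)
        _ ≤ Δ 0 * Real.exp (-(r * l1norm (lam t))) * Real.exp (-(r * α (t + 1))) := by gcongr
        _ = Δ 0 * Real.exp (-(r * (l1norm (lam t) + α (t + 1)))) := by
            rw [mul_assoc, ← Real.exp_add]; congr 2; ring
        _ ≤ _ := by
            have := hΔ0 0
            gcongr
  obtain ⟨Z, hZ⟩ := h.exists_eq (mul_pos hm' hb)
  have hC := h.admissible Z
  set C := (relConst ℓ Z).toReal
  have hC0 : 0 < C := by linarith [hC.1]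
  have hz : ∀ t, ∀ i ∉ H, Real.exp ((A *ᵥ lam t) i) ≤ C * (m * Δ t) := by
    intro t i hi
    have h1 := hC.exp_le (apply_le_of_risk_le h (z := A *ᵥ lam t)
      (by rw [hZ]; exact mul_le_mul_of_nonneg_left (hle t) hm'.le) i) (i := 0) (by norm_num)
    rw [iteratedDeriv_zero] at h1
    exact h1.trans (mul_le_mul_of_nonneg_left (loss_le_excess h _ hi) hC0.le)
  -- The `+ 1` makes the argument positive even if `Δ 0 = 0`.
  set K := Real.log (C * (m * Δ 0) + 1) with hK
  have hbase : 0 < C * (m * Δ 0) + 1 := by have := hΔ0 0; positivity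
  have hmargin : ∀ t, ∀ i ∉ H, (A *ᵥ lam t) i ≤ K - r * l1norm (lam t) := by
    intro t i hi
    rw [← Real.exp_le_exp, sub_eq_add_neg, Real.exp_add, hK, Real.exp_log hbase]
    calc _ ≤ _ := hz t i hi
      _ ≤ C * (m * (Δ 0 * Real.exp (-(r * l1norm (lam t))))) := by gcongr; exact hexp t
      _ = C * (m * Δ 0) * Real.exp (-(r * l1norm (lam t))) := by ring
      _ ≤ _ := by gcongr; linarith
  -- Norm at least `E` gives `|K| ≤ (r / 2) ‖λ‖₁`, and the `+ 1` keeps the norm positive. The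
  -- tolerance below is chosen so that `C m ε = exp (-E)`.
  set E := 2 * |K| / r + 1 with hE
  obtain ⟨T, hT⟩ := exists_le_of_quadratic_decrease (by positivity) hΔ0 hquad
    (ε := Real.exp (-E) / (C * m)) (by positivity)
  refine ⟨r / 2, by positivity, T, fun t ht i hi => ?_⟩
  have h1 : (A *ᵥ lam t) i ≤ -E := by
    rw [← Real.exp_le_exp]
    have := hT t ht
    rw [le_div_iff₀ (by positivity)] at this
    linarith [hz t i hi, show C * (m * Δ t) = Δ t * (C * m) by ring]
  have h2 : E ≤ l1norm (lam t) := by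
    have := (abs_le.1 (abs_mulVec_le hA (lam t) i)).1
    linarith
  have hE1 : 1 ≤ E := by
    have : 0 ≤ 2 * |K| / r := by positivity
    linarith
  have h3 : |K| ≤ r / 2 * l1norm (lam t) := by
    have : 2 * |K| / r ≤ l1norm (lam t) := by linarith
    rw [div_le_iff₀ hrpos] at this
    linarith
  rw [margin, le_div_iff₀ (by linarith)]
  linarith [hmargin t i hi, le_abs_self K]

end Boosting

/-- The conclusion includes `λ_t ≠ 0`: division by zero would make the margin `0`, while `γ' > 0`
and some example lies off the core. -/
theorem mainTheorem8 {m n : ℕ} (A : Matrix (Fin m) (Fin n) ℝ)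
    (hA : ∀ i j, A i j ∈ Set.Icc (-1 : ℝ) 1)
    (H : Finset (Fin m)) (hH : Boosting.IsHardCore A H)
    (hH1 : 1 ≤ H.card) (hHm : H.card ≤ m - 1)
    (ν : ℝ) (hν : ν ∈ Set.Ioc (0 : ℝ) 1)
    (ℓ : ℝ → ℝ) (hℓ : Boosting.IsLossInfty ℓ)
    (lam v : ℕ → Fin n → ℝ) (α : ℕ → ℝ)
    (hrun : Boosting.IsBoostRun ℓ A lam v α)
    (hstep :
      (∀ t, Boosting.IsQubStep ℓ A ν (lam t) (α (t + 1))) ∨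
      (∀ t, Boosting.IsWolfeStep ℓ A ν (lam t) (v (t + 1)) (α (t + 1))) ∨
      (ℓ = Real.exp ∧ Boosting.IsBinary A ∧
        ∀ t, Boosting.IsOptStep ℓ A ν (lam t) (v (t + 1)) (α (t + 1))) ∨
      (ℓ = Real.exp ∧ Boosting.IsBinary A ∧
        ∀ t, Boosting.IsAdaStep ℓ A ν (lam t) (α (t + 1)))) :
    ∃ γ' : ℝ, 0 < γ' ∧ ∃ T : ℕ, ∀ t ≥ T, ∀ i ∉ H, γ' ≤ Boosting.margin A (lam t) i := by
  have h := hℓ.toIsLoss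
  have hne : H.Nonempty := Finset.card_pos.1 hH1
  have hm : 0 < m := hne.choose.pos
  have hb := Boosting.risk_pos h hm (A *ᵥ lam 0)
  obtain ⟨i, hi⟩ : ∃ i, i ∉ H := by
    by_contra! hall
    have := Finset.card_eq_iff_eq_univ H |>.2 (Finset.eq_univ_iff_forall.2 hall)
    rw [Fintype.card_fin] at this
    omega
  have hG := hH.pullGrad_norm_pos h hi
  have hdir := hrun.direction
  rcases hstep with hs | hs | ⟨rfl, hbin, hs⟩ | ⟨rfl, hbin, hs⟩
  · obtain ⟨c, hc, hcs⟩ := Boosting.exists_qub_constant h hm hA hν hb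
    exact hH.exists_margin hne hA h hrun hc fun t ht => hcs _ _ _ ht (hG _) (hdir t) (hs t)
  · obtain ⟨c, hc, hcs⟩ := Boosting.exists_wolfe_constant h hm hA hν hb
    exact hH.exists_margin hne hA h hrun hc fun t ht => hcs _ _ _ ht (hG _) (hdir t) (hs t)
  · obtain ⟨c, hc, hcs⟩ := hH.exists_opt_constant hne h hbin hν hb
    exact hH.exists_margin hne hA h hrun hc fun t ht => hcs _ _ _ ht (hdir t) (hs t)
  · obtain ⟨c, hc, hcs⟩ := hH.exists_ada_constant hne h hbin hν hb
    exact hH.exists_margin hne hA h hrun hc fun t ht => hcs _ _ _ ht (hdir t) (hs t)
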